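/- A \emph{topological graph} is a compact connected metric space that is a union of finitely many arcs (subspaces homeomorphic to $[0,1]$) such that any two distinct arcs intersect at most in common end points. A \emph{transformation group} $(G,X)$ consists of a compact Hausdorff space $X$, a discrete group $G$, and a continuous action $G\times X\to X$ of $G$ on $X$. A subset $Y\subseteq X$ is \emph{invariant} if it is nonempty and $gy\in Y$ for all $g\in G$, $y\in Y$. The \emph{height} $h(G,X)\in\{0,1,2,\ldots\}\cup\{+\infty\}$ is the supremum of all integers $n\ge 0$ for which there exist distinct closed invariant subsets $Y_0\subset Y_1\subset\cdots\subset Y_n=X$. Let $P_h(X)$ denote the set of the heights $h(G,X)$ of all transformation groups $(G,X)$ with phase space $X$. \textbf{Theorem.} For every integer $p\ge 0$ there is a topological graph $\mathcal{G}$ such that \[P_h(\mathcal{G})=\{p,p+1,p+2,\ldots\}\cup\{+\infty\}.\] -/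

import Mathlib

universe u

/-- A topological graph: a compact connected metric space that is a finite union of arcs
(subspaces homeomorphic to `[0,1]`, here the ranges of embeddings `γ i` of `[0,1]`), any two of
which meet at most in common end points. -/
def IsTopologicalGraph (X : Type*) [MetricSpace X] : Prop :=
  CompactSpace X ∧ ConnectedSpace X ∧
    ∃ (n : ℕ) (γ : Fin n → unitInterval → X),
      (∀ i, Topology.IsEmbedding (γ i)) ∧
      (⋃ i, Set.range (γ i)) = Set.univ ∧
      ∀ i j, i ≠ j →
        Set.range (γ i) ∩ Set.range (γ j) ⊆ {γ i 0, γ i 1} ∩ {γ j 0, γ j 1}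

/-- A closed invariant subset of a transformation group `(G, X)`; invariant subsets are
nonempty by convention. -/
def IsClosedInvariant (G : Type*) {X : Type*} [TopologicalSpace X] [Group G] [MulAction G X]
    (Y : Set X) : Prop :=
  Y.Nonempty ∧ IsClosed Y ∧ ∀ g : G, ∀ y ∈ Y, g • y ∈ Y

/-- The height `h(G, Y)` of a closed invariant subset `Y`: the supremum of all `n` for which there
is a chain `Y₀ ⊂ Y₁ ⊂ ⋯ ⊂ Yₙ = Y` of distinct closed invariant subsets. -/
noncomputable def invariantHeight (G : Type*) {X : Type*} [TopologicalSpace X] [Group G]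
    [MulAction G X] (Y : Set X) : ℕ∞ :=
  sSup {h : ℕ∞ | ∃ n : ℕ, h = (n : ℕ∞) ∧ ∃ C : Fin (n + 1) → Set X,
    StrictMono C ∧ (∀ i, IsClosedInvariant G (C i)) ∧ C (Fin.last n) = Y}

/-- `P_h(X)`: the set of the heights `h(G, X)` of all transformation groups `(G, X)` with phase
space `X`, where `G` is a discrete group acting continuously on `X`. Letting `G` range over the
universe of `X` is no restriction: the closed invariant sets of `(G, X)` are those of the image of
`G` in the group of self-homeomorphisms of `X`. -/
def possibleHeights (X : Type u) [TopologicalSpace X] : Set ℕ∞ :=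
  {h | ∃ (G : Type u) (_ : Group G) (_ : TopologicalSpace G) (_ : DiscreteTopology G)
    (_ : MulAction G X) (_ : ContinuousSMul G X), h = invariantHeight G (Set.univ : Set X)}

/-! The graph is a chain of `p + 1` diamonds, `necklace (p + 1)`, whose cut points are the `p`
points where consecutive diamonds touch. A homeomorphism permutes the cut points and preserves the
number of them on each side of a cut point. It therefore preserves the partition by `depth`, the
horizontal distance to the nearer end, into the positive integer values and the open gaps around
them, where all depths below 1 count as one gap. An end of the necklace is merely a point on a
circle, so it is not distinguished (`necklace.stratum_depth_map`). This gives `p + 1` strata that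
are invariant under every group.

If `k + 1` strata are invariant, list the point strata first and the open strata afterwards. Initial
unions are then closed, so the height is at least `k` (`le_invariantHeight_of_strata`). If the group
is moreover transitive on each stratum, every invariant set is a union of strata, so the height is
exactly `k` (`invariantHeight_le_of_strata`).

Hence every height is at least `p`. To realise `p + e`, the function `rescale e` stretches the
depths in `[0, 1/2]` so that they create `e` further strata. The group of all homeomorphisms
preserving the refined strata is transitive on each of them (`necklace.strataGroup_transitive`). The
trivial group preserves the strata for every `e`, so its height is infinite. -/

/-- The distance from a real number to the nearest integer. -/
noncomputable def tent (x : ℝ) : ℝ := |x - round x|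

lemma tent_nonneg (x : ℝ) : 0 ≤ tent x := abs_nonneg _

lemma tent_le_half (x : ℝ) : tent x ≤ 1 / 2 := abs_sub_round x

lemma tent_le (x : ℝ) (m : ℤ) : tent x ≤ |x - m| := round_le x m

lemma continuous_tent : Continuous tent := by
  refine LipschitzWith.continuous (K := 1) (LipschitzWith.of_le_add fun x y => ?_)
  calc tent x ≤ |x - round y| := tent_le x _
    _ ≤ |x - y| + |y - round y| := abs_sub_le _ _ _
    _ = tent y + dist x y := by rw [Real.dist_eq, tent, add_comm]

lemma tent_eq_zero_iff {x : ℝ} : tent x = 0 ↔ ∃ m : ℤ, x = m := by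
  constructor
  · intro h
    exact ⟨round x, sub_eq_zero.mp (abs_eq_zero.mp h)⟩
  · rintro ⟨m, rfl⟩
    simp [tent]

@[simp] lemma tent_intCast (m : ℤ) : tent m = 0 := tent_eq_zero_iff.2 ⟨m, rfl⟩

@[simp] lemma tent_natCast (m : ℕ) : tent m = 0 := mod_cast tent_intCast m

@[simp] lemma tent_zero : tent 0 = 0 := mod_cast tent_natCast 0

lemma tent_eq_self {x : ℝ} (h0 : 0 ≤ x) (h1 : x ≤ 1 / 2) : tent x = x := by
  refine le_antisymm (by simpa [abs_of_nonneg h0] using tent_le x 0) ?_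
  rcases le_or_gt (round x) 0 with h | h
  · have h' : (round x : ℝ) ≤ 0 := mod_cast h
    exact le_trans (by linarith) (le_abs_self _)
  · have h' : (1 : ℝ) ≤ round x := mod_cast h
    exact le_trans (by linarith) (neg_le_abs _)

lemma tent_natCast_sub (n : ℕ) (x : ℝ) : tent (n - x) = tent x := by
  have key : ∀ y : ℝ, tent (n - y) ≤ tent y := fun y => by
    refine (tent_le _ ((n : ℤ) - round y)).trans_eq ?_
    rw [tent, ← abs_neg]
    push_cast
    congr 1
    ring
  refine le_antisymm (key x) ?_
  simpa using key (n - x)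

/-! ### The necklace as a topological graph -/

/-- A chain of `n` diamonds in the plane, consecutive ones touching at a point. -/
def necklace (n : ℕ) : Set (ℝ × ℝ) := {q | 0 ≤ q.1 ∧ q.1 ≤ n ∧ |q.2| = tent q.1}

namespace necklace

variable {n : ℕ}

lemma isCompact (n : ℕ) : IsCompact (necklace n) := by
  refine IsCompact.of_isClosed_subset
    (isCompact_Icc (a := ((0 : ℝ), (-1 : ℝ))) (b := ((n : ℝ), (1 : ℝ)))) ?_ ?_
  · refine (isClosed_le continuous_const continuous_fst).inter
      ((isClosed_le continuous_fst continuous_const).inter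
        (isClosed_eq (continuous_abs.comp continuous_snd) (continuous_tent.comp continuous_fst)))
  · rintro ⟨x, y⟩ ⟨h0, h1, h2⟩
    have := abs_le.mp (h2.le.trans (tent_le_half x))
    exact ⟨⟨h0, by simp only; linarith⟩, ⟨h1, by simp only; linarith⟩⟩

/-- The point over `t` on the upper (`ε = 1`) or lower (`ε = -1`) side of the necklace;
`t` is clamped to `[0, n]`. -/
noncomputable def pt (n : ℕ) (ε : ℤˣ) (t : ℝ) : necklace n :=
  ⟨(max 0 (min n t), ((ε : ℤ) : ℝ) * tent (max 0 (min n t))), le_max_left _ _,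
    max_le (Nat.cast_nonneg n) (min_le_left _ _), by
      have : |((ε : ℤ) : ℝ)| = 1 := by rcases Int.units_eq_one_or ε with rfl | rfl <;> simp
      rw [abs_mul, this, one_mul, abs_of_nonneg (tent_nonneg _)]⟩

lemma continuous_pt (ε : ℤˣ) : Continuous (pt n ε) := by
  have h : Continuous fun t : ℝ => max 0 (min (n : ℝ) t) := by fun_prop
  exact (h.prodMk (continuous_const.mul (continuous_tent.comp h))).subtype_mk _

lemma pt_val (ε : ℤˣ) {t : ℝ} (h0 : 0 ≤ t) (h1 : t ≤ n) :
    (pt n ε t).1 = (t, ((ε : ℤ) : ℝ) * tent t) := by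
  simp [pt, h0, h1]

lemma pt_fst (ε : ℤˣ) {t : ℝ} (h0 : 0 ≤ t) (h1 : t ≤ n) : (pt n ε t).1.1 = t := by
  rw [pt_val ε h0 h1]

lemma exists_pt_eq (Q : necklace n) : ∃ ε, pt n ε Q.1.1 = Q := by
  obtain ⟨⟨x, y⟩, h0, h1, h2⟩ := Q
  simp only at h0 h1 h2
  rcases abs_choice y with h | h
  · refine ⟨1, Subtype.ext ?_⟩
    rw [pt_val _ h0 h1]
    simp [← h2, h]
  · refine ⟨-1, Subtype.ext ?_⟩
    rw [pt_val _ h0 h1]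
    simp [← h2, h]

/-- Points over an integer do not depend on the side. -/
lemma eq_of_fst_eq {P Q : necklace n} (h : P.1.1 = Q.1.1) (h0 : tent P.1.1 = 0) : P = Q := by
  have hP := P.2.2.2
  have hQ := Q.2.2.2
  rw [← h, h0, abs_eq_zero] at hQ
  rw [h0, abs_eq_zero] at hP
  exact Subtype.ext (Prod.ext h (hP.trans hQ.symm))

lemma isPreconnected_pt_image (ε : ℤˣ) (a b : ℝ) : IsPreconnected (pt n ε '' Set.Icc a b) :=
  isPreconnected_Icc.image _ (continuous_pt ε).continuousOn

/-- A set is preconnected if with each point it contains the arc from there to the left end. -/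
lemma isPreconnected_of_left {S : Set (necklace n)}
    (h : ∀ ε : ℤˣ, ∀ q : ℝ, 0 ≤ q → q ≤ n → pt n ε q ∈ S → ∀ t, 0 ≤ t → t ≤ q → pt n ε t ∈ S) :
    IsPreconnected S := by
  refine isPreconnected_of_forall (pt n 1 0) fun Q hQ => ?_
  obtain ⟨ε, hε⟩ := exists_pt_eq Q
  refine ⟨pt n ε '' Set.Icc 0 Q.1.1, ?_, ?_, ?_, isPreconnected_pt_image _ _ _⟩
  · rintro _ ⟨t, ht, rfl⟩
    exact h ε _ Q.2.1 Q.2.2.1 (by rwa [hε]) t ht.1 ht.2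
  · refine ⟨0, ⟨le_rfl, Q.2.1⟩, ?_⟩
    exact eq_of_fst_eq (by simp [pt]) (by simp [pt])
  · exact ⟨_, ⟨Q.2.1, le_rfl⟩, hε⟩

/-- A set is preconnected if with each point it contains the arc from there to the right end. -/
lemma isPreconnected_of_right {S : Set (necklace n)}
    (h : ∀ ε : ℤˣ, ∀ q : ℝ, 0 ≤ q → q ≤ n → pt n ε q ∈ S → ∀ t, q ≤ t → t ≤ n → pt n ε t ∈ S) :
    IsPreconnected S := by
  refine isPreconnected_of_forall (pt n 1 n) fun Q hQ => ?_
  obtain ⟨ε, hε⟩ := exists_pt_eq Q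
  refine ⟨pt n ε '' Set.Icc Q.1.1 n, ?_, ?_, ?_, isPreconnected_pt_image _ _ _⟩
  · rintro _ ⟨t, ht, rfl⟩
    exact h ε _ Q.2.1 Q.2.2.1 (by rwa [hε]) t ht.1 ht.2
  · refine ⟨n, ⟨Q.2.2.1, le_rfl⟩, ?_⟩
    exact eq_of_fst_eq (by simp [pt]) (by simp [pt])
  · exact ⟨_, ⟨le_rfl, Q.2.2.1⟩, hε⟩

/-- The closed arc of the necklace between the integers `i` and `i + 1` on the side `ε`. -/
noncomputable def arc (i : Fin n) (ε : ℤˣ) (t : unitInterval) : necklace n :=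
  pt n ε ((i : ℕ) + (t : ℝ))

lemma arc_mem_Icc (i : Fin n) (t : unitInterval) :
    0 ≤ ((i : ℕ) : ℝ) + (t : ℝ) ∧ ((i : ℕ) : ℝ) + (t : ℝ) ≤ n := by
  have h : ((i : ℕ) : ℝ) + 1 ≤ n := mod_cast i.2
  exact ⟨add_nonneg (Nat.cast_nonneg _) t.2.1, by linarith [t.2.2]⟩

lemma arc_val (i : Fin n) (ε : ℤˣ) (t : unitInterval) :
    (arc i ε t).1 = ((i : ℕ) + (t : ℝ), ((ε : ℤ) : ℝ) * tent ((i : ℕ) + (t : ℝ))) :=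
  pt_val ε (arc_mem_Icc i t).1 (arc_mem_Icc i t).2

lemma isEmbedding_arc (i : Fin n) (ε : ℤˣ) : Topology.IsEmbedding (arc i ε) := by
  have hc : Continuous (arc i ε) :=
    (continuous_pt ε).comp (continuous_const.add continuous_subtype_val)
  refine (hc.isClosedEmbedding fun s t h => ?_).isEmbedding
  have := congrArg (fun Q : necklace n => Q.1.1) h
  simp only [arc_val] at this
  exact Subtype.ext (by linarith)

lemma exists_arc_eq (hn : 0 < n) (Q : necklace n) : ∃ i : Fin n, ∃ ε t, arc i ε t = Q := by
  obtain ⟨ε, hε⟩ := exists_pt_eq Q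
  have h0 := Q.2.1
  rcases Q.2.2.1.lt_or_eq with h | h
  · refine ⟨⟨⌊Q.1.1⌋₊, (Nat.floor_lt h0).2 h⟩, ε, ⟨Q.1.1 - ⌊Q.1.1⌋₊, ?_, ?_⟩, ?_⟩
    · linarith [Nat.floor_le h0]
    · linarith [Nat.lt_floor_add_one Q.1.1]
    · simpa [arc] using hε
  -- At the right end the integer part is `n`, which indexes no arc; this point is the final end of
  -- the last arc.
  · refine ⟨⟨n - 1, by omega⟩, ε, 1, ?_⟩
    have : ((n - 1 : ℕ) : ℝ) + 1 = n := by exact_mod_cast Nat.sub_add_cancel hn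
    simpa [arc, this, ← h] using hε

lemma mem_arc_ends {i : Fin n} {ε : ℤˣ} {Q : necklace n} (hQ : Q ∈ Set.range (arc i ε))
    (h0 : tent Q.1.1 = 0) : Q ∈ ({arc i ε 0, arc i ε 1} : Set (necklace n)) := by
  obtain ⟨t, rfl⟩ := hQ
  rw [arc_val] at h0
  obtain ⟨m, hm⟩ := tent_eq_zero_iff.1 h0
  have h1 : (t : ℝ) = ((m - (i : ℕ) : ℤ) : ℝ) := by push_cast; linarith
  have h2 := t.2.1
  have h3 := t.2.2
  rw [h1] at h2 h3
  have h2' : 0 ≤ m - ((i : ℕ) : ℤ) := by exact_mod_cast h2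
  have h3' : m - ((i : ℕ) : ℤ) ≤ 1 := by exact_mod_cast h3
  have h4 : m - ((i : ℕ) : ℤ) = 0 ∨ m - ((i : ℕ) : ℤ) = 1 := by omega
  rcases h4 with h4 | h4
  · left
    rw [h4] at h1
    congr 1
    exact Subtype.ext (by simpa using h1)
  · right
    rw [h4] at h1
    rw [Set.mem_singleton_iff]
    congr 1
    exact Subtype.ext (by simpa using h1)

/-- Arcs over different unit intervals can share only a point over an integer, and the two sides
over one interval are separated by the sign of the second coordinate unless that coordinate
vanishes. -/
lemma tent_eq_zero_of_mem_arcs {i j : Fin n} {ε δ : ℤˣ} (hne : (i, ε) ≠ (j, δ)) {Q : necklace n}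
    (hi : Q ∈ Set.range (arc i ε)) (hj : Q ∈ Set.range (arc j δ)) : tent Q.1.1 = 0 := by
  have aux : ∀ {i j : Fin n} {s t : unitInterval}, i < j →
      ((i : ℕ) : ℝ) + (s : ℝ) = (j : ℕ) + (t : ℝ) → tent ((i : ℕ) + (s : ℝ)) = 0 := by
    intro i j s t hij h
    have h1 : ((i : ℕ) : ℝ) + 1 ≤ (j : ℕ) := mod_cast hij
    have h2 : ((i : ℕ) : ℝ) + (s : ℝ) = (j : ℕ) := by linarith [s.2.2, t.2.1]
    rw [h2, tent_natCast]
  obtain ⟨s, rfl⟩ := hi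
  obtain ⟨t, ht⟩ := hj
  have h := congrArg Subtype.val ht
  rw [arc_val, arc_val, Prod.mk.injEq] at h
  rw [arc_val]
  rcases lt_trichotomy i j with hij | rfl | hij
  · exact aux hij h.1.symm
  · rw [h.1] at h
    by_contra h0
    have h1 := mul_right_cancel₀ h0 h.2
    exact hne (by rw [Units.ext (Int.cast_injective h1)])
  · simpa [h.1] using aux hij h.1

lemma isTopologicalGraph (hn : 0 < n) : IsTopologicalGraph (necklace n) := by
  refine ⟨isCompact_iff_compactSpace.mp (isCompact n), ?_, ?_⟩
  · have : PreconnectedSpace (necklace n) :=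
      ⟨isPreconnected_of_left fun _ _ _ _ _ _ _ _ => Set.mem_univ _⟩
    exact { toNonempty := ⟨pt n 1 0⟩ }
  let e := (Fintype.equivFin (Fin n × ℤˣ)).symm
  refine ⟨_, fun k => arc (e k).1 (e k).2, fun k => isEmbedding_arc _ _, ?_, ?_⟩
  · refine Set.eq_univ_of_forall fun Q => ?_
    obtain ⟨i, ε, t, h⟩ := exists_arc_eq hn Q
    refine Set.mem_iUnion.2 ⟨e.symm (i, ε), t, ?_⟩
    simpa using h
  · intro k l hkl Q hQ
    have h0 := tent_eq_zero_of_mem_arcs (fun h => hkl (e.injective h)) hQ.1 hQ.2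
    exact ⟨mem_arc_ends hQ.1 h0, mem_arc_ends hQ.2 h0⟩

end necklace

/-! ### Height bounds from invariant functions -/

section Height

variable {G X : Type*} [TopologicalSpace X] [Group G] [MulAction G X]

/-- An invariant function with closed sublevel sets and `k + 1` values forces height at
least `k`. -/
lemma le_invariantHeight_of_invariant {c : X → ℤ} {S : Finset ℤ} {k : ℕ}
    (hS : Set.range c = S) (hk : S.card = k + 1) (hclosed : ∀ t, IsClosed {x | c x ≤ t})
    (hinv : ∀ (g : G) x, c (g • x) = c x) :
    (k : ℕ∞) ≤ invariantHeight G (Set.univ : Set X) := by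
  let e := S.orderEmbOfFin hk
  have he : ∀ i, ∃ x, c x = e i := fun i => by
    have : e i ∈ (S : Set ℤ) := S.orderEmbOfFin_mem hk i
    rwa [← hS] at this
  -- The chain consists of the sublevel sets at the `k + 1` values of `c`, taken in increasing
  -- order.
  refine le_sSup ⟨k, rfl, fun i => {x | c x ≤ e i}, ?_, fun i => ⟨?_, hclosed _, ?_⟩, ?_⟩
  · intro i j hij
    refine ⟨fun x (hx : c x ≤ e i) => hx.trans (e.monotone hij.le), fun h => ?_⟩
    obtain ⟨x, hx⟩ := he j
    have h1 : c x ≤ e i := h (show c x ≤ e j from hx.le)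
    exact (e.strictMono hij).not_ge (hx ▸ h1)
  · obtain ⟨x, hx⟩ := he i
    exact ⟨x, hx.le⟩
  · intro g y hy
    simpa only [Set.mem_ofPred_eq, hinv] using hy
  · refine Set.eq_univ_of_forall fun x => ?_
    have hx : c x ∈ Set.range e := by
      rw [S.range_orderEmbOfFin hk, ← hS]
      exact ⟨x, rfl⟩
    obtain ⟨i, hi⟩ := hx
    exact hi.symm.trans_le (e.monotone (Fin.le_last i))

/-- If the fibres of a function with `k + 1` values are contained in orbits, then the height is
at most `k`. -/
lemma invariantHeight_le_of_transitive {c : X → ℤ} {S : Finset ℤ} {k : ℕ}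
    (hS : Set.range c = S) (hk : S.card = k + 1)
    (htrans : ∀ x y, c x = c y → ∃ g : G, g • x = y) :
    invariantHeight G (Set.univ : Set X) ≤ k := by
  classical
  refine sSup_le ?_
  rintro _ ⟨m, rfl, C, hC, hinv, -⟩
  have hsub : ∀ i, c '' C i ⊆ S := fun i => hS ▸ Set.image_subset_range _ _
  -- By transitivity on fibres, an invariant set is the full preimage of its set of values, so a
  -- strict chain of invariant sets gives a strict chain of subsets of `S`.
  let D : Fin (m + 1) → Finset ℤ := fun i => S.filter (· ∈ c '' C i)
  have hD : StrictMono D := by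
    intro i j hij
    refine Finset.ssubset_iff_subset_ne.2 ⟨fun z hz => ?_, fun h => ?_⟩
    · rw [Finset.mem_filter] at hz ⊢
      exact ⟨hz.1, Set.image_mono (hC hij).1 hz.2⟩
    · refine (hC hij).2 fun y hy => ?_
      have hy' : c y ∈ D j := Finset.mem_filter.2 ⟨hsub j ⟨y, hy, rfl⟩, ⟨y, hy, rfl⟩⟩
      rw [← h, Finset.mem_filter] at hy'
      obtain ⟨-, x, hx, hxy⟩ := hy'
      obtain ⟨g, rfl⟩ := htrans x y hxy
      exact (hinv i).2.2 g x hx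
  -- The extra 1 comes from the convention that invariant sets are nonempty.
  have hcard : ∀ i : Fin (m + 1), (i : ℕ) + 1 ≤ (D i).card := by
    intro i
    induction i using Fin.induction with
    | zero =>
      obtain ⟨x, hx⟩ := (hinv 0).1
      exact Finset.card_pos.2 ⟨c x, Finset.mem_filter.2 ⟨hsub 0 ⟨x, hx, rfl⟩, ⟨x, hx, rfl⟩⟩⟩
    | succ i ih =>
      have := Finset.card_lt_card (hD i.castSucc_lt_succ)
      simp only [Fin.val_castSucc, Fin.val_succ] at ih ⊢
      omega
  have h1 := hcard (Fin.last m)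
  have h2 := Finset.card_le_card (Finset.filter_subset (· ∈ c '' C (Fin.last m)) S)
  have h3 : m + 1 ≤ k + 1 := by
    rw [← hk]
    rw [Fin.val_last] at h1
    exact h1.trans h2
  exact mod_cast (by omega : m ≤ k)

end Height

/-- The self-homeomorphisms of `X` act on `X` by evaluation. -/
instance homeomorphAction (X : Type*) [TopologicalSpace X] : MulAction (X ≃ₜ X) X where
  smul h x := h x
  one_smul _ := rfl
  mul_smul _ _ _ := rfl

/-- A group of self-homeomorphisms yields a possible height. -/
lemma invariantHeight_mem_possibleHeights {X : Type} [TopologicalSpace X]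
    (Γ : Subgroup (X ≃ₜ X)) :
    invariantHeight Γ (Set.univ : Set X) ∈ possibleHeights X := by
  let _ : TopologicalSpace Γ := ⊥
  have : DiscreteTopology Γ := ⟨rfl⟩
  refine ⟨Γ, inferInstance, inferInstance, inferInstance, inferInstance, ⟨?_⟩, rfl⟩
  exact continuous_prod_of_discrete_left.2 fun g => g.1.continuous

/-! ### Stratification of the line by the integers -/

/-- The index of the stratum of `t`: `2 * m` for the integer `m`, and `2 * m + 1` for the open
interval between `m` and `m + 1`. -/
noncomputable def stratum (t : ℝ) : ℤ := ⌊t⌋ + ⌈t⌉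

lemma monotone_stratum : Monotone stratum := fun _ _ h =>
  add_le_add (Int.floor_mono h) (Int.ceil_mono h)

@[simp] lemma stratum_intCast (m : ℤ) : stratum m = 2 * m := by
  simp [stratum, two_mul]

lemma stratum_eq_odd {t : ℝ} {m : ℤ} : stratum t = 2 * m + 1 ↔ (m : ℝ) < t ∧ t < m + 1 := by
  have h1 := Int.floor_le_ceil t
  have h2 := Int.ceil_le_floor_add_one t
  constructor
  · intro h
    unfold stratum at h
    have h3 : ⌊t⌋ = m := by omega
    have h4 : ⌈t⌉ = m + 1 := by omega
    have h5 := Int.floor_eq_iff.1 h3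
    have h6 := Int.ceil_eq_iff.1 h4
    refine ⟨?_, h5.2⟩
    have := h6.1
    push_cast at this
    linarith
  · rintro ⟨h3, h4⟩
    have h5 : ⌊t⌋ = m := Int.floor_eq_iff.2 ⟨h3.le, h4⟩
    have h6 : ⌈t⌉ = m + 1 := Int.ceil_eq_iff.2 ⟨by push_cast; linarith, by push_cast; linarith⟩
    rw [stratum, h5, h6]
    ring

lemma stratum_eq_even {t : ℝ} {m : ℤ} : stratum t = 2 * m ↔ t = m := by
  constructor
  · intro h
    have h1 := Int.floor_le_ceil t
    have h2 := Int.ceil_le_floor_add_one t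
    unfold stratum at h
    have h3 : ⌊t⌋ = m := by omega
    have h4 : ⌈t⌉ = m := by omega
    exact le_antisymm (h4 ▸ Int.le_ceil t) (h3 ▸ Int.floor_le t)
  · rintro rfl
    exact stratum_intCast m

lemma isOpen_stratum_odd (B : Set ℤ) : IsOpen {t : ℝ | ∃ m ∈ B, stratum t = 2 * m + 1} := by
  have : {t : ℝ | ∃ m ∈ B, stratum t = 2 * m + 1} = ⋃ m ∈ B, Set.Ioo (m : ℝ) (m + 1) := by
    ext t
    simp only [stratum_eq_odd, Set.mem_ofPred_eq, Set.mem_iUnion, Set.mem_Ioo, exists_prop]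
  rw [this]
  exact isOpen_biUnion fun _ _ => isOpen_Ioo

lemma isClosed_stratum_even (A : Set ℤ) : IsClosed {t : ℝ | ∃ m ∈ A, stratum t = 2 * m} := by
  have : {t : ℝ | ∃ m ∈ A, stratum t = 2 * m} = ((↑) : ℤ → ℝ) '' A := by
    ext t
    simp only [stratum_eq_even, Set.mem_ofPred_eq, Set.mem_image]
    exact ⟨fun ⟨m, h, e⟩ => ⟨m, h, e.symm⟩, fun ⟨m, h, e⟩ => ⟨m, h, e.symm⟩⟩
  rw [this]
  exact Int.isClosedEmbedding_coe_real.isClosedMap _ (isClosed_discrete A)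

/-- The order of strata in which, among the strata with indices in `[a, b]`, all points precede
all intervals. -/
def stratumRank (a b z : ℤ) : ℤ := if Even z then z else z + (b - a + 1)

lemma stratumRank_injOn (a b : ℤ) : Set.InjOn (stratumRank a b) (Set.Icc a b) := by
  intro x hx y hy h
  unfold stratumRank at h
  simp only [Set.mem_Icc] at hx hy
  split_ifs at h <;> omega

/-- Point strata have rank at most `b` and open strata have rank above `b`. For `t ≤ b` the set is
thus the preimage of a set of integers, which is closed; for `t > b` its complement is the preimage
of a union of open unit intervals. -/
lemma isClosed_stratumRank_le {X : Type*} [TopologicalSpace X] {τ : X → ℝ} (hτ : Continuous τ)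
    {a b : ℤ} (hab : ∀ x, stratum (τ x) ∈ Set.Icc a b) (t : ℤ) :
    IsClosed {x | stratumRank a b (stratum (τ x)) ≤ t} := by
  rcases le_or_gt t b with ht | ht
  · have : {x | stratumRank a b (stratum (τ x)) ≤ t} =
        τ ⁻¹' {s : ℝ | ∃ m ∈ {m : ℤ | 2 * m ≤ t}, stratum s = 2 * m} := by
      ext x
      have hx := hab x
      simp only [Set.mem_Icc] at hx
      simp only [Set.mem_ofPred_eq, Set.mem_preimage, stratumRank]
      constructor
      · intro h
        split_ifs at h with he
        · obtain ⟨m, hm⟩ := he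
          exact ⟨m, by omega, by omega⟩
        · omega
      · rintro ⟨m, hm, h⟩
        rw [if_pos ⟨m, by omega⟩]
        omega
    rw [this]
    exact (isClosed_stratum_even _).preimage hτ
  · rw [← isOpen_compl_iff]
    have : {x | stratumRank a b (stratum (τ x)) ≤ t}ᶜ =
        τ ⁻¹' {s : ℝ | ∃ m ∈ {m : ℤ | t < 2 * m + 1 + (b - a + 1)}, stratum s = 2 * m + 1} := by
      ext x
      have hx := hab x
      simp only [Set.mem_Icc] at hx
      simp only [Set.mem_ofPred_eq, Set.mem_compl_iff, Set.mem_preimage, stratumRank]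
      constructor
      · intro h
        split_ifs at h with he
        · omega
        · obtain ⟨m, hm⟩ := Int.not_even_iff_odd.1 he
          exact ⟨m, by omega, by omega⟩
      · rintro ⟨m, hm, h⟩
        rw [if_neg (Int.not_even_iff_odd.2 ⟨m, h⟩)]
        omega
    rw [this]
    exact (isOpen_stratum_odd _).preimage hτ

/-- Height bounds in terms of a real function whose strata are invariant. -/
lemma le_invariantHeight_of_strata {G X : Type*} [TopologicalSpace X] [Group G] [MulAction G X]
    {τ : X → ℝ} (hτ : Continuous τ) {a b : ℤ} {k : ℕ} (hk : b + 1 - a = k + 1)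
    (hab : Set.range (fun x => stratum (τ x)) = Set.Icc a b)
    (hinv : ∀ (g : G) x, stratum (τ (g • x)) = stratum (τ x)) :
    (k : ℕ∞) ≤ invariantHeight G (Set.univ : Set X) := by
  refine le_invariantHeight_of_invariant (c := fun x => stratumRank a b (stratum (τ x)))
    (S := (Finset.Icc a b).image (stratumRank a b)) ?_ ?_ ?_ ?_
  · rw [Finset.coe_image, Finset.coe_Icc, ← hab, ← Set.range_comp]
    rfl
  · rw [Finset.card_image_of_injOn (by simpa using stratumRank_injOn a b), Int.card_Icc]
    omega
  · exact isClosed_stratumRank_le hτ fun x => hab ▸ ⟨x, rfl⟩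
  · intro g x
    simp only [hinv]

lemma invariantHeight_le_of_strata {G X : Type*} [TopologicalSpace X] [Group G] [MulAction G X]
    {τ : X → ℝ} {a b : ℤ} {k : ℕ} (hk : b + 1 - a = k + 1)
    (hab : Set.range (fun x => stratum (τ x)) = Set.Icc a b)
    (htrans : ∀ x y, stratum (τ x) = stratum (τ y) → ∃ g : G, g • x = y) :
    invariantHeight G (Set.univ : Set X) ≤ k := by
  refine invariantHeight_le_of_transitive (c := fun x => stratum (τ x))
    (S := Finset.Icc a b) (by rw [hab, Finset.coe_Icc]) ?_ htrans
  rw [Int.card_Icc]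
  omega

/-- Half-integers represent all strata, which lets the intermediate value theorem find every stratum
in a range. -/
lemma stratum_intCast_div_two (z : ℤ) : stratum ((z : ℝ) / 2) = z := by
  obtain ⟨m, rfl | rfl⟩ := Int.even_or_odd' z
  · rw [stratum_eq_even]
    push_cast
    ring
  · rw [stratum_eq_odd]
    push_cast
    constructor <;> linarith

/-! ### Creating extra strata by rescaling -/

/-- A piecewise linear function, of slope `e` before `1 / 2` and the identity after it. -/
noncomputable def rescale (e : ℕ) (s : ℝ) : ℝ := max s (1 / 2) + e * min (s - 1 / 2) 0

lemma continuous_rescale (e : ℕ) : Continuous (rescale e) := by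
  unfold rescale
  fun_prop

lemma monotone_rescale (e : ℕ) : Monotone (rescale e) := fun s t h => by
  unfold rescale
  gcongr

lemma rescale_of_le (e : ℕ) {s : ℝ} (h : s ≤ 1 / 2) : rescale e s = 1 / 2 + e * (s - 1 / 2) := by
  rw [rescale, max_eq_right h, min_eq_left (by linarith)]

lemma rescale_of_ge (e : ℕ) {s : ℝ} (h : 1 / 2 ≤ s) : rescale e s = s := by
  rw [rescale, max_eq_left h, min_eq_right (by linarith), mul_zero, add_zero]

/-- The stratum after rescaling determines the points of the point strata. -/
lemma eq_of_rescale_eq_intCast {e : ℕ} {s t : ℝ} {m : ℤ} (hs : rescale e s = m)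
    (ht : rescale e t = m) : s = t := by
  -- For `e = 0` the function is constant on `(-∞, 1/2]`, but the constant `1 / 2` is not an
  -- integer; for `e > 0` it is strictly increasing.
  rcases Nat.eq_zero_or_pos e with rfl | he
  · have key : ∀ {s : ℝ}, rescale 0 s = m → s = m := fun {s} hs => by
      rcases le_total s (1 / 2) with h | h
      · rw [rescale_of_le 0 h] at hs
        have h1 : ((2 * m : ℤ) : ℝ) = (1 : ℤ) := by
          push_cast at hs ⊢
          linarith
        have := Int.cast_injective h1
        omega
      · rwa [rescale_of_ge 0 h] at hs
    rw [key hs, key ht]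
  · have hmono : StrictMono (rescale e) := by
      intro a b hab
      unfold rescale
      have he' : (0 : ℝ) < e := mod_cast he
      rcases le_or_gt (1 / 2) b with hb | hb
      · rcases le_or_gt (1 / 2) a with ha | ha
        · rw [max_eq_left hb, max_eq_left ha, min_eq_right (by linarith),
            min_eq_right (by linarith)]
          linarith
        · rw [max_eq_left hb, max_eq_right ha.le, min_eq_right (a := b - 1 / 2) (by linarith),
            min_eq_left (by linarith)]
          nlinarith
      · rw [max_eq_right hb.le, max_eq_right (by linarith), min_eq_left (by linarith),
          min_eq_left (by linarith)]
        nlinarith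
    exact hmono.injective (hs.trans ht.symm)

/-- The stratum for `e = 0` depends only on data that cut points can detect: comparison with
positive integers, and being one. Everything below 1 falls into stratum 1, so 0 plays no special
role. -/
lemma stratum_rescale_congr {s t : ℝ} (hs : 0 ≤ s)
    (hlt : ∀ m : ℕ, 0 < m → (s < m ↔ t < m))
    (hint : (∃ m : ℤ, 0 < m ∧ s = m) ↔ ∃ m : ℤ, 0 < m ∧ t = m) :
    stratum (rescale 0 s) = stratum (rescale 0 t) := by
  have hr : ∀ u, rescale 0 u = max u (1 / 2) := fun u => by simp [rescale]
  rw [hr, hr]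
  rcases lt_or_ge s 1 with h1 | h1
  · have h2 : t < 1 := by simpa using (hlt 1 one_pos).1 (by simpa using h1)
    have key : ∀ u : ℝ, u < 1 → stratum (max u (1 / 2)) = 2 * 0 + 1 := fun u hu => by
      rw [stratum_eq_odd]
      push_cast
      exact ⟨lt_max_of_lt_right (by norm_num), max_lt (by linarith) (by norm_num)⟩
    rw [key s h1, key t h2]
  · have h2 : 1 ≤ t := by simpa using (not_congr (hlt 1 one_pos)).1 (by simpa using h1)
    rw [max_eq_left (by linarith), max_eq_left (by linarith)]
    have hk : 0 < ⌊s⌋₊ := Nat.floor_pos.2 h1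
    have hs1 := Nat.floor_le hs
    have hs2 := Nat.lt_floor_add_one s
    have ht1 : (⌊s⌋₊ : ℝ) ≤ t := not_lt.1 ((not_congr (hlt _ hk)).1 hs1.not_gt)
    have ht2 : t < (⌊s⌋₊ : ℝ) + 1 := by
      exact_mod_cast (hlt (⌊s⌋₊ + 1) (Nat.succ_pos _)).1 (by exact_mod_cast hs2)
    set k := ⌊s⌋₊
    have key : ∀ u : ℝ, (k : ℝ) ≤ u → u < k + 1 → (∃ m : ℤ, 0 < m ∧ u = m) → u = k := by
      rintro u hu1 hu2 ⟨m, -, rfl⟩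
      have h3 : (k : ℤ) ≤ m := by exact_mod_cast hu1
      have h4 : m < k + 1 := by exact_mod_cast hu2
      have h5 : m = k := by omega
      rw [h5, Int.cast_natCast]
    by_cases hi : ∃ m : ℤ, 0 < m ∧ s = m
    · rw [key s hs1 hs2 hi, key t ht1 ht2 (hint.1 hi)]
    · have hne : ∀ u : ℝ, (¬∃ m : ℤ, 0 < m ∧ u = m) → u ≠ k := fun u hu e =>
        hu ⟨k, by exact_mod_cast hk, by simpa using e⟩
      have odd : ∀ u : ℝ, (k : ℝ) ≤ u → u < k + 1 → u ≠ k → stratum u = 2 * k + 1 :=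
        fun u hu1 hu2 hu => stratum_eq_odd.2 ⟨by simpa using hu1.lt_of_ne' hu, by simpa using hu2⟩
      rw [odd s hs1 hs2 (hne s hi), odd t ht1 ht2 (hne t (mt hint.2 hi))]

/-! ### Depth and its strata -/

namespace necklace

variable {n : ℕ}

/-- The horizontal distance to the nearer end of the necklace. -/
noncomputable def depth (Q : necklace n) : ℝ := min Q.1.1 (n - Q.1.1)

lemma continuous_depth : Continuous (depth (n := n)) := by
  unfold depth
  fun_prop

lemma depth_nonneg (Q : necklace n) : 0 ≤ depth Q := le_min Q.2.1 (sub_nonneg.2 Q.2.2.1)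

lemma depth_le (Q : necklace n) : depth Q ≤ n / 2 := by
  rcases le_total Q.1.1 (n / 2) with h | h
  · exact (min_le_left _ _).trans h
  · exact (min_le_right _ _).trans (by linarith)

lemma depth_pt (ε : ℤˣ) {t : ℝ} (h0 : 0 ≤ t) (h1 : t ≤ n / 2) : depth (pt n ε t) = t := by
  rw [depth, pt_fst ε h0 (by linarith)]
  exact min_eq_left (by linarith)

/-- Depth fills `[0, n / 2]`, and the rescaled ends of this interval are the half-integers `(1 - e)
/ 2` and `n / 2`. All intermediate strata occur by continuity, so there are `n + e` of them. -/
lemma range_stratum_depth (hn : 0 < n) (e : ℕ) :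
    Set.range (fun Q : necklace n => stratum (rescale e (depth Q))) =
      Set.Icc (1 - (e : ℤ)) n := by
  have h0 : rescale e 0 = ((1 - (e : ℤ) : ℤ) : ℝ) / 2 := by
    rw [rescale_of_le e (by norm_num)]
    push_cast
    ring
  have hn' : (1 : ℝ) ≤ n := mod_cast hn
  have h1 : rescale e (n / 2) = ((n : ℤ) : ℝ) / 2 := by
    rw [rescale_of_ge e (by linarith)]
    simp
  apply Set.Subset.antisymm
  · rintro _ ⟨Q, rfl⟩
    constructor
    · rw [← stratum_intCast_div_two (1 - (e : ℤ)), ← h0]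
      exact monotone_stratum (monotone_rescale e (depth_nonneg Q))
    · rw [← stratum_intCast_div_two (n : ℤ), ← h1]
      exact monotone_stratum (monotone_rescale e (depth_le Q))
  · intro z hz
    have hz1 : ((1 - (e : ℤ) : ℤ) : ℝ) ≤ z := mod_cast hz.1
    have hz2 : (z : ℝ) ≤ ((n : ℤ) : ℝ) := mod_cast hz.2
    have hmem : (z : ℝ) / 2 ∈ Set.Icc (rescale e 0) (rescale e (n / 2)) := by
      rw [h0, h1]
      constructor <;> linarith
    obtain ⟨s, hs, hsz⟩ := intermediate_value_Icc (by linarith)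
      (continuous_rescale e).continuousOn hmem
    refine ⟨pt n 1 s, ?_⟩
    simp only
    rw [depth_pt 1 hs.1 hs.2, hsz, stratum_intCast_div_two]

/-! ### Cut points -/

/-- The cut points of a space. -/
def cutPoints (X : Type*) [TopologicalSpace X] : Set X := {x | ¬ IsPreconnected ({x}ᶜ : Set X)}

lemma mem_cutPoints_map {X : Type*} [TopologicalSpace X] (h : X ≃ₜ X) (x : X) :
    h x ∈ cutPoints X ↔ x ∈ cutPoints X := by
  unfold cutPoints
  rw [Set.mem_ofPred_eq, Set.mem_ofPred_eq, ← Set.image_singleton, ← Set.image_compl_eq h.bijective,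
    h.isPreconnected_image]

lemma isPreconnected_lt (a : ℝ) : IsPreconnected {Q : necklace n | Q.1.1 < a} := by
  refine isPreconnected_of_left fun ε q h0 h1 hq t ht0 htq => ?_
  rw [Set.mem_ofPred_eq, pt_fst ε h0 h1] at hq
  rw [Set.mem_ofPred_eq, pt_fst ε ht0 (htq.trans h1)]
  exact htq.trans_lt hq

lemma isPreconnected_gt (a : ℝ) : IsPreconnected {Q : necklace n | a < Q.1.1} := by
  refine isPreconnected_of_right fun ε q h0 h1 hq t htq htn => ?_
  rw [Set.mem_ofPred_eq, pt_fst ε h0 h1] at hq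
  rw [Set.mem_ofPred_eq, pt_fst ε (h0.trans htq) htn]
  exact hq.trans_le htq

lemma compl_singleton_eq {v : necklace n} (hv : tent v.1.1 = 0) :
    ({v}ᶜ : Set (necklace n)) = {Q | Q.1.1 < v.1.1} ∪ {Q | v.1.1 < Q.1.1} := by
  ext Q
  rw [Set.mem_compl_iff, Set.mem_singleton_iff, Set.mem_union, Set.mem_ofPred_eq,
    Set.mem_ofPred_eq, ← ne_iff_lt_or_gt]
  exact not_congr ⟨fun h => h ▸ rfl, fun h => (eq_of_fst_eq h.symm hv).symm⟩

lemma isOpen_lt_fst (a : ℝ) : IsOpen {Q : necklace n | Q.1.1 < a} :=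
  isOpen_lt (by fun_prop) continuous_const

lemma isOpen_gt_fst (a : ℝ) : IsOpen {Q : necklace n | a < Q.1.1} :=
  isOpen_lt continuous_const (by fun_prop)

lemma disjoint_lt_gt (a : ℝ) :
    Disjoint {Q : necklace n | Q.1.1 < a} {Q : necklace n | a < Q.1.1} :=
  Set.disjoint_left.2 fun _ h1 h2 => lt_asymm (a := a) h2 h1

lemma component_of_lt {v Q : necklace n} (hv : tent v.1.1 = 0) (hQ : Q.1.1 < v.1.1) :
    connectedComponentIn {v}ᶜ Q = {P | P.1.1 < v.1.1} := by
  have hmem : Q ∈ ({v}ᶜ : Set (necklace n)) := fun h => hQ.ne (by rw [h])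
  apply Set.Subset.antisymm
  · refine isPreconnected_connectedComponentIn.subset_left_of_subset_union (isOpen_lt_fst _)
      (isOpen_gt_fst _) (disjoint_lt_gt _) ?_ ⟨Q, mem_connectedComponentIn hmem, hQ⟩
    rw [← compl_singleton_eq hv]
    exact connectedComponentIn_subset _ _
  · refine (isPreconnected_lt _).subset_connectedComponentIn hQ ?_
    rw [compl_singleton_eq hv]
    exact Set.subset_union_left

lemma component_of_gt {v Q : necklace n} (hv : tent v.1.1 = 0) (hQ : v.1.1 < Q.1.1) :
    connectedComponentIn {v}ᶜ Q = {P | v.1.1 < P.1.1} := by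
  have hmem : Q ∈ ({v}ᶜ : Set (necklace n)) := fun h => hQ.ne' (by rw [h])
  apply Set.Subset.antisymm
  · refine isPreconnected_connectedComponentIn.subset_right_of_subset_union (isOpen_lt_fst _)
      (isOpen_gt_fst _) (disjoint_lt_gt _) ?_ ⟨Q, mem_connectedComponentIn hmem, hQ⟩
    rw [← compl_singleton_eq hv]
    exact connectedComponentIn_subset _ _
  · refine (isPreconnected_gt _).subset_connectedComponentIn hQ ?_
    rw [compl_singleton_eq hv]
    exact Set.subset_union_right

/-- The side opposite to `P` is intact and runs from one end of the necklace to the other. Any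
remaining point on the side of `P` reaches one of the two ends along its own side, in the direction
away from `P`. -/
lemma isPreconnected_compl_of_tent_ne_zero {P : necklace n} (hP : tent P.1.1 ≠ 0) :
    IsPreconnected ({P}ᶜ : Set (necklace n)) := by
  obtain ⟨ε, hε⟩ := exists_pt_eq P
  have hother : ∀ t, pt n (-ε) t ≠ P := fun t ht => by
    have h1 : (pt n (-ε) t).1.1 = P.1.1 := by rw [ht]
    have h2 : (pt n (-ε) t).1.2 = P.1.2 := by rw [ht]
    have h3 : (pt n (-ε) t).1.2 = -((ε : ℤ) : ℝ) * tent (pt n (-ε) t).1.1 := by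
      simp [pt]
    have h4 : P.1.2 = ((ε : ℤ) : ℝ) * tent P.1.1 := by
      conv_lhs => rw [← hε, pt_val ε P.2.1 P.2.2.1]
    rw [h3, h1, h4] at h2
    have h5 := mul_right_cancel₀ hP h2
    rcases Int.units_eq_one_or ε with rfl | rfl <;> norm_num at h5
  have hrange : Set.range (pt n (-ε)) ⊆ {P}ᶜ := by
    rintro _ ⟨t, rfl⟩
    exact hother t
  refine isPreconnected_of_forall (pt n (-ε) 0) fun Q hQ => ?_
  obtain ⟨δ, hδ⟩ := exists_pt_eq Q
  rcases Int.units_eq_one_or (δ * ε) with hδε | hδε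
  swap
  · have hδ' : δ = -ε := by
      rcases Int.units_eq_one_or ε with rfl | rfl <;>
        rcases Int.units_eq_one_or δ with rfl | rfl <;> simp_all
    refine ⟨Set.range (pt n (-ε)), hrange, ⟨0, rfl⟩, ⟨Q.1.1, by rw [← hδ', hδ]⟩,
      isPreconnected_range (continuous_pt _)⟩
  have hδ' : δ = ε := by
    rcases Int.units_eq_one_or ε with rfl | rfl <;>
      rcases Int.units_eq_one_or δ with rfl | rfl <;> simp_all
  rw [hδ'] at hδ
  have hne : Q.1.1 ≠ P.1.1 := fun h => hQ (by rw [Set.mem_singleton_iff, ← hδ, h, hε])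
  have h0 : pt n ε 0 = pt n (-ε) 0 := eq_of_fst_eq (by simp [pt]) (by simp [pt])
  have h1 : pt n ε n = pt n (-ε) n := eq_of_fst_eq (by simp [pt]) (by simp [pt])
  rcases lt_or_gt_of_ne hne with h | h
  · refine ⟨pt n ε '' Set.Icc 0 Q.1.1 ∪ Set.range (pt n (-ε)), ?_, Or.inr ⟨0, rfl⟩,
      Or.inl ⟨_, ⟨Q.2.1, le_rfl⟩, hδ⟩, ?_⟩
    · refine Set.union_subset ?_ hrange
      rintro _ ⟨t, ht, rfl⟩ htP
      rw [Set.mem_singleton_iff] at htP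
      rw [← htP, pt_fst ε ht.1 (ht.2.trans Q.2.2.1)] at h
      exact h.not_ge ht.2
    · exact (isPreconnected_pt_image _ _ _).union _ ⟨0, ⟨le_rfl, Q.2.1⟩, h0⟩ ⟨0, rfl⟩
        (isPreconnected_range (continuous_pt _))
  · refine ⟨pt n ε '' Set.Icc Q.1.1 n ∪ Set.range (pt n (-ε)), ?_, Or.inr ⟨0, rfl⟩,
      Or.inl ⟨_, ⟨le_rfl, Q.2.2.1⟩, hδ⟩, ?_⟩
    · refine Set.union_subset ?_ hrange
      rintro _ ⟨t, ht, rfl⟩ htP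
      rw [Set.mem_singleton_iff] at htP
      rw [← htP, pt_fst ε (Q.2.1.trans ht.1) ht.2] at h
      exact h.not_ge ht.1
    · exact (isPreconnected_pt_image _ _ _).union _ ⟨n, ⟨Q.2.2.1, le_rfl⟩, h1⟩ ⟨n, rfl⟩
        (isPreconnected_range (continuous_pt _))

lemma mem_cutPoints_iff {P : necklace n} :
    P ∈ cutPoints (necklace n) ↔ tent P.1.1 = 0 ∧ 0 < P.1.1 ∧ P.1.1 < n := by
  constructor
  · intro h
    have h0 : tent P.1.1 = 0 := by
      by_contra h0
      exact h (isPreconnected_compl_of_tent_ne_zero h0)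
    refine ⟨h0, P.2.1.lt_of_ne' fun h1 => h ?_, P.2.2.1.lt_of_ne fun h1 => h ?_⟩
    -- At an end of the necklace one of the two halves of the complement is empty, so the end does
    -- not cut.
    · rw [compl_singleton_eq h0, Set.eq_empty_of_forall_notMem (s := {Q : necklace n | Q.1.1 < P.1.1}),
        Set.empty_union]
      · exact isPreconnected_gt _
      · exact fun Q (hQ : Q.1.1 < P.1.1) => (h1 ▸ hQ).not_ge Q.2.1
    · rw [compl_singleton_eq h0, Set.eq_empty_of_forall_notMem (s := {Q : necklace n | P.1.1 < Q.1.1}),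
        Set.union_empty]
      · exact isPreconnected_lt _
      · exact fun Q (hQ : P.1.1 < Q.1.1) => (h1 ▸ hQ).not_ge Q.2.2.1
  · rintro ⟨h0, h1, h2⟩ h
    rw [compl_singleton_eq h0] at h
    have hl : pt n 1 0 ∈ {Q : necklace n | Q.1.1 < P.1.1} := by simpa [pt] using h1
    have hr : pt n 1 n ∈ {Q : necklace n | P.1.1 < Q.1.1} := by simpa [pt] using h2
    have := h.subset_left_of_subset_union (isOpen_lt_fst _) (isOpen_gt_fst _) (disjoint_lt_gt _)
      subset_rfl ⟨_, Or.inl hl, hl⟩ (Or.inr hr)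
    exact lt_asymm (a := P.1.1) hr this

lemma cutPoints_eq (p : ℕ) : cutPoints (necklace (p + 1)) =
    (fun j : ℕ => pt (p + 1) 1 j) '' Set.Icc 1 p := by
  ext P
  rw [mem_cutPoints_iff]
  constructor
  · rintro ⟨h0, h1, h2⟩
    obtain ⟨m, hm⟩ := tent_eq_zero_iff.1 h0
    rw [hm] at h1 h2
    have h1' : 0 < m := mod_cast h1
    have h2' : m < p + 1 := by exact_mod_cast h2
    lift m to ℕ using h1'.le
    refine ⟨m, ⟨by omega, by omega⟩, (eq_of_fst_eq ?_ h0).symm⟩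
    have : P.1.1 = (m : ℝ) := by simpa using hm
    simp only
    rw [← this, pt_fst 1 P.2.1 P.2.2.1]
  · rintro ⟨j, ⟨h1, h2⟩, rfl⟩
    have h2' : (j : ℝ) < ((p + 1 : ℕ) : ℝ) := by exact_mod_cast Nat.lt_succ_of_le h2
    simp only
    rw [pt_fst 1 (Nat.cast_nonneg j) h2'.le]
    exact ⟨tent_natCast j, by exact_mod_cast h1, h2'⟩

lemma pt_natCast_fst {p j : ℕ} (hj : j ≤ p + 1) : (pt (p + 1) 1 j).1.1 = j :=
  pt_fst 1 (Nat.cast_nonneg j) (by exact_mod_cast hj)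

lemma ncard_cutPoints_inter {p : ℕ} (S : Set (necklace (p + 1))) (T : Finset ℕ)
    (hT : T ⊆ Finset.Icc 1 p) (h : ∀ j ∈ Finset.Icc 1 p, pt (p + 1) 1 j ∈ S ↔ j ∈ T) :
    (cutPoints (necklace (p + 1)) ∩ S).ncard = T.card := by
  have : cutPoints (necklace (p + 1)) ∩ S = (fun j : ℕ => pt (p + 1) 1 j) '' (T : Set ℕ) := by
    rw [cutPoints_eq]
    ext P
    constructor
    · rintro ⟨⟨j, hj, rfl⟩, hS⟩
      exact ⟨j, (h j (by simpa using hj)).1 hS, rfl⟩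
    · rintro ⟨j, hj, rfl⟩
      exact ⟨⟨j, by simpa using hT hj, rfl⟩, (h j (hT hj)).2 hj⟩
  rw [this, Set.InjOn.ncard_image, Set.ncard_coe_finset]
  intro i hi j hj hij
  have hi' := Finset.mem_Icc.1 (hT hi)
  have hj' := Finset.mem_Icc.1 (hT hj)
  have h3 := congrArg (fun Q : necklace (p + 1) => Q.1.1) hij
  simp only [pt_natCast_fst (show i ≤ p + 1 by omega),
    pt_natCast_fst (show j ≤ p + 1 by omega)] at h3
  exact_mod_cast h3

/-! ### Recovering the depth from cut points -/

/-- The number of cut points on the side of the point `v` on which `Q` lies. -/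
noncomputable def cutCount {X : Type*} [TopologicalSpace X] (v Q : X) : ℕ :=
  (cutPoints X ∩ connectedComponentIn {v}ᶜ Q).ncard

lemma cutCount_map {X : Type*} [TopologicalSpace X] (h : X ≃ₜ X) {v Q : X} (hvQ : Q ≠ v) :
    cutCount (h v) (h Q) = cutCount v Q := by
  have h1 : cutPoints X = h '' cutPoints X := by
    ext x
    constructor
    · intro hx
      refine ⟨h.symm x, ?_, h.apply_symm_apply x⟩
      rwa [← mem_cutPoints_map h, h.apply_symm_apply]
    · rintro ⟨y, hy, rfl⟩
      exact (mem_cutPoints_map h y).2 hy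
  have h2 : ({h v}ᶜ : Set X) = h '' {v}ᶜ := by
    rw [Set.image_compl_eq h.bijective, Set.image_singleton]
  unfold cutCount
  rw [h2, ← h.image_connectedComponentIn (by exact hvQ)]
  conv_lhs => rw [h1]
  rw [← Set.image_inter h.injective, Set.ncard_image_of_injective _ h.injective]

lemma cutCount_of_lt {p j : ℕ} (hj : j ∈ Finset.Icc 1 p) {Q : necklace (p + 1)}
    (hQ : Q.1.1 < j) : cutCount (pt (p + 1) 1 j) Q = j - 1 := by
  rw [Finset.mem_Icc] at hj
  have hfst := pt_natCast_fst (show j ≤ p + 1 by omega)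
  rw [cutCount, component_of_lt (by rw [hfst, tent_natCast]) (by rwa [hfst]),
    ncard_cutPoints_inter _ (Finset.Icc 1 (j - 1)), Nat.card_Icc]
  · omega
  · exact Finset.Icc_subset_Icc_right (by omega)
  · intro i hi
    rw [Finset.mem_Icc] at hi
    rw [Set.mem_ofPred_eq, hfst, pt_natCast_fst (show i ≤ p + 1 by omega), Nat.cast_lt,
      Finset.mem_Icc]
    omega

lemma cutCount_of_gt {p j : ℕ} (hj : j ∈ Finset.Icc 1 p) {Q : necklace (p + 1)}
    (hQ : (j : ℝ) < Q.1.1) : cutCount (pt (p + 1) 1 j) Q = p - j := by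
  rw [Finset.mem_Icc] at hj
  have hfst := pt_natCast_fst (show j ≤ p + 1 by omega)
  rw [cutCount, component_of_gt (by rw [hfst, tent_natCast]) (by rwa [hfst]),
    ncard_cutPoints_inter _ (Finset.Icc (j + 1) p), Nat.card_Icc]
  · omega
  · exact Finset.Icc_subset_Icc_left (by omega)
  · intro i hi
    rw [Finset.mem_Icc] at hi
    rw [Set.mem_ofPred_eq, hfst, pt_natCast_fst (show i ≤ p + 1 by omega), Nat.cast_lt,
      Finset.mem_Icc]
    omega

/-- The depth of a point up to integer part, in topological terms. -/
lemma depth_lt_iff {p r : ℕ} (hr : r < p) (Q : necklace (p + 1)) :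
    depth Q < r + 1 ↔ ∃ v ∈ cutPoints (necklace (p + 1)), Q ≠ v ∧ cutCount v Q ≤ r := by
  constructor
  · intro h
    rw [depth, min_lt_iff] at h
    rcases h with h | h
    -- The cut point over `r + 1` has exactly `r` cut points to its left; symmetrically, the one
    -- over `p - r` used below has `r` to its right. Both exist because `r < p`.
    · have hmem : r + 1 ∈ Finset.Icc 1 p := Finset.mem_Icc.2 ⟨by omega, by omega⟩
      have h' : Q.1.1 < ((r + 1 : ℕ) : ℝ) := by push_cast; exact h
      refine ⟨pt (p + 1) 1 (r + 1 : ℕ), ?_, ?_, ?_⟩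
      · rw [cutPoints_eq]
        exact ⟨r + 1, by simpa using hmem, rfl⟩
      · intro hQ
        rw [hQ, pt_natCast_fst (by omega)] at h'
        exact lt_irrefl _ h'
      · rw [cutCount_of_lt hmem h']
        omega
    · have hmem : p - r ∈ Finset.Icc 1 p := Finset.mem_Icc.2 ⟨by omega, by omega⟩
      have h' : ((p - r : ℕ) : ℝ) < Q.1.1 := by
        rw [Nat.cast_sub hr.le]
        push_cast at h
        linarith
      refine ⟨pt (p + 1) 1 (p - r : ℕ), ?_, ?_, ?_⟩
      · rw [cutPoints_eq]
        exact ⟨p - r, by simpa using hmem, rfl⟩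
      · intro hQ
        rw [hQ, pt_natCast_fst (by omega)] at h'
        exact lt_irrefl _ h'
      · rw [cutCount_of_gt hmem h']
        omega
  · rintro ⟨v, hv, hne, hcount⟩
    rw [cutPoints_eq] at hv
    obtain ⟨j, hj, rfl⟩ := hv
    have hmem : j ∈ Finset.Icc 1 p := by simpa using hj
    have hfst := pt_natCast_fst (show j ≤ p + 1 from hj.2.trans (Nat.le_succ p))
    rw [depth, min_lt_iff]
    have hne' : Q.1.1 ≠ j := fun h =>
      hne (eq_of_fst_eq (by rw [hfst, h]) (by rw [h, tent_natCast]))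
    rcases lt_or_gt_of_ne hne' with h | h
    · left
      simp only [cutCount_of_lt hmem h] at hcount
      have : (j : ℝ) ≤ r + 1 := by exact_mod_cast (by omega : j ≤ r + 1)
      linarith
    · right
      simp only [cutCount_of_gt hmem h] at hcount
      have : (p : ℝ) ≤ r + j := by exact_mod_cast (by omega : p ≤ r + j)
      push_cast
      linarith

lemma mem_cutPoints_iff_depth {p : ℕ} {Q : necklace (p + 1)} :
    Q ∈ cutPoints (necklace (p + 1)) ↔ ∃ m : ℤ, 0 < m ∧ depth Q = m := by
  rw [mem_cutPoints_iff, tent_eq_zero_iff]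
  constructor
  · rintro ⟨⟨m, hm⟩, h0, h1⟩
    rw [hm] at h0 h1
    rcases min_choice Q.1.1 ((p + 1 : ℕ) - Q.1.1) with h | h
    · exact ⟨m, by exact_mod_cast h0, by rw [depth, h, hm]⟩
    · refine ⟨(p + 1 : ℕ) - m, ?_, by rw [depth, h, hm]; push_cast; rfl⟩
      have : m < (p + 1 : ℕ) := by exact_mod_cast h1
      omega
  · rintro ⟨m, h0, hm⟩
    have hpos : 0 < depth Q := by rw [hm]; exact_mod_cast h0
    obtain ⟨h1, h2⟩ := lt_min_iff.1 hpos
    refine ⟨?_, h1, by linarith⟩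
    rcases min_choice Q.1.1 ((p + 1 : ℕ) - Q.1.1) with h | h
    · exact ⟨m, by rw [← hm, depth, h]⟩
    · refine ⟨(p + 1 : ℕ) - m, ?_⟩
      push_cast
      rw [← hm, depth, h]
      push_cast
      ring

/-- Every self-homeomorphism of the necklace preserves the strata of the depth. -/
lemma stratum_depth_map {p : ℕ} (h : necklace (p + 1) ≃ₜ necklace (p + 1))
    (Q : necklace (p + 1)) :
    stratum (rescale 0 (depth (h Q))) = stratum (rescale 0 (depth Q)) := by
  have hlt : ∀ m : ℕ, 0 < m → (depth (h Q) < m ↔ depth Q < m) := by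
    intro m hm
    obtain ⟨r, rfl⟩ := Nat.exists_eq_add_of_le' hm
    rcases lt_or_ge r p with hr | hr
    · push_cast
      rw [depth_lt_iff hr, depth_lt_iff hr]
      constructor
      · rintro ⟨v, hv, hne, hle⟩
        have hne' : Q ≠ h.symm v := fun e => hne (by rw [e, h.apply_symm_apply])
        refine ⟨h.symm v, ?_, hne', ?_⟩
        · rwa [← mem_cutPoints_map h, h.apply_symm_apply]
        · rwa [← cutCount_map h hne', h.apply_symm_apply]
      · rintro ⟨v, hv, hne, hle⟩
        exact ⟨h v, (mem_cutPoints_map h v).2 hv, h.injective.ne hne, by rwa [cutCount_map h hne]⟩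
    -- Here the bound is vacuous: no depth exceeds `(p + 1) / 2`, which is less than `r + 1`.
    · have hp : (p : ℝ) ≤ r := mod_cast hr
      have : ∀ P : necklace (p + 1), depth P < ((r + 1 : ℕ) : ℝ) := fun P =>
        (depth_le P).trans_lt (by push_cast; linarith [(Nat.cast_nonneg p : (0 : ℝ) ≤ p)])
      exact iff_of_true (this _) (this _)
  have hcut : (∃ m : ℤ, 0 < m ∧ depth (h Q) = m) ↔ ∃ m : ℤ, 0 < m ∧ depth Q = m := by
    rw [← mem_cutPoints_iff_depth, ← mem_cutPoints_iff_depth, mem_cutPoints_map]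
  exact stratum_rescale_congr (depth_nonneg _) hlt hcut

end necklace

/-! ### Homeomorphisms moving points within a stratum -/

/-- A monotone bijection of the line that moves `s` to `t` and is the identity off `(a, b)`. -/
lemma exists_orderIso_of_mem_Ioo {a b s t : ℝ} (hs : s ∈ Set.Ioo a b) (ht : t ∈ Set.Ioo a b) :
    ∃ φ : ℝ ≃o ℝ, φ s = t ∧ ∀ u, u ∉ Set.Ioo a b → φ u = u := by
  wlog hst : s ≤ t generalizing s t
  · obtain ⟨φ, h1, h2⟩ := this ht hs (le_of_not_ge hst)
    exact ⟨φ.symm, by rw [← h1, φ.symm_apply_apply],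
      fun u hu => by conv_lhs => rw [← h2 u hu, φ.symm_apply_apply]⟩
  obtain ⟨hs1, hs2⟩ := hs
  obtain ⟨ht1, ht2⟩ := ht
  have hA : 0 < (t - a) / (s - a) := div_pos (by linarith) (by linarith)
  have hB : 0 < (b - t) / (b - s) := div_pos (by linarith) (by linarith)
  have hA1 : 1 ≤ (t - a) / (s - a) := (one_le_div (by linarith)).2 (by linarith)
  have hB1 : (b - t) / (b - s) ≤ 1 := (div_le_one (by linarith)).2 (by linarith)
  have hAs : (t - a) / (s - a) * (s - a) = t - a := div_mul_cancel₀ _ (by linarith)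
  have hBs : (b - t) / (b - s) * (b - s) = b - t := div_mul_cancel₀ _ (by linarith)
  set A := (t - a) / (s - a)
  set B := (b - t) / (b - s)
  -- The two affine functions join `(a, a)` to `(s, t)` and `(s, t)` to `(b, b)`, with slopes `A ≥ 1
  -- ≥ B > 0`. Off `(a, b)` their minimum is at most `u`, so the maximum restores the identity
  -- there.
  let f : ℝ → ℝ := fun u => max u (min (a + A * (u - a)) (b - B * (b - u)))
  have hf : StrictMono f := fun u v huv =>
    max_lt_max huv (min_lt_min (by nlinarith) (by nlinarith))
  have hcont : Continuous f := by fun_prop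
  have hfix : ∀ u, u ∉ Set.Ioo a b → f u = u := fun u hu => by
    refine max_eq_left ?_
    rcases le_or_gt u a with h | h
    · exact (min_le_left _ _).trans (by nlinarith)
    · have hb : b ≤ u := not_lt.1 fun h' => hu ⟨h, h'⟩
      exact (min_le_right _ _).trans (by nlinarith)
  have hsurj : Function.Surjective f := fun y => by
    have h1 : f (min a y) = min a y := hfix _ fun h => h.1.not_ge (min_le_left _ _)
    have h2 : f (max b y) = max b y := hfix _ fun h => h.2.not_ge (le_max_left _ _)
    obtain ⟨u, -, hu⟩ := intermediate_value_Icc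
      ((min_le_right a y).trans (le_max_right b y)) hcont.continuousOn
      (show y ∈ Set.Icc (f (min a y)) (f (max b y)) by
        rw [h1, h2]
        exact ⟨min_le_right _ _, le_max_right _ _⟩)
    exact ⟨u, hu⟩
  refine ⟨hf.orderIsoOfSurjective f hsurj, ?_, fun u hu => ?_⟩
  · rw [StrictMono.coe_orderIsoOfSurjective]
    simp only [f]
    rw [hAs, hBs, min_eq_left (by linarith), max_eq_right (by linarith)]
    ring
  · rw [StrictMono.coe_orderIsoOfSurjective]
    exact hfix u hu

lemma OrderIso.mem_Ioo_of_fixed {φ : ℝ ≃o ℝ} {a b : ℝ} (hφ : ∀ u, u ∉ Set.Ioo a b → φ u = u)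
    {u : ℝ} (hu : u ∈ Set.Ioo a b) : φ u ∈ Set.Ioo a b := by
  have ha : φ a = a := hφ a fun h => lt_irrefl _ h.1
  have hb : φ b = b := hφ b fun h => lt_irrefl _ h.2
  exact ⟨ha ▸ φ.strictMono hu.1, hb ▸ φ.strictMono hu.2⟩

namespace necklace

variable {n : ℕ}

lemma pt_one_of_nonneg {Q : necklace n} (h : 0 ≤ Q.1.2) : pt n 1 Q.1.1 = Q := by
  refine Subtype.ext ?_
  rw [pt_val 1 Q.2.1 Q.2.2.1]
  refine Prod.ext rfl ?_
  rw [← Q.2.2.2, abs_of_nonneg h]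
  simp

/-- The reflection of the necklace in the horizontal axis. -/
def flip (n : ℕ) : necklace n ≃ₜ necklace n where
  toFun Q := ⟨(Q.1.1, -Q.1.2), Q.2.1, Q.2.2.1, by simpa using Q.2.2.2⟩
  invFun Q := ⟨(Q.1.1, -Q.1.2), Q.2.1, Q.2.2.1, by simpa using Q.2.2.2⟩
  left_inv Q := by simp
  right_inv Q := by simp
  continuous_toFun := by fun_prop
  continuous_invFun := by fun_prop

lemma mirror_mem (Q : necklace n) : ((n : ℝ) - Q.1.1, Q.1.2) ∈ necklace n :=
  ⟨sub_nonneg.2 Q.2.2.1, sub_le_self _ Q.2.1, by rw [tent_natCast_sub]; exact Q.2.2.2⟩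

/-- The reflection of the necklace that exchanges its ends. -/
def mirror (n : ℕ) : necklace n ≃ₜ necklace n where
  toFun Q := ⟨(n - Q.1.1, Q.1.2), mirror_mem Q⟩
  invFun Q := ⟨(n - Q.1.1, Q.1.2), mirror_mem Q⟩
  left_inv Q := by simp
  right_inv Q := by simp
  continuous_toFun := by fun_prop
  continuous_invFun := by fun_prop

lemma depth_flip (Q : necklace n) : depth (flip n Q) = depth Q := rfl

lemma depth_mirror (Q : necklace n) : depth (mirror n Q) = depth Q := by
  simp [depth, mirror, min_comm]

/-- The map of the necklace that moves the points of the upper side by `φ`. -/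
noncomputable def pushFun (n : ℕ) (φ : ℝ → ℝ) (Q : necklace n) : necklace n :=
  if 0 ≤ Q.1.2 then pt n 1 (φ Q.1.1) else Q

/-- The moved upper side and the unmoved lower side meet only over integers, which `φ` fixes. -/
lemma continuous_pushFun {φ : ℝ → ℝ} (hc : Continuous φ) (hφ : ∀ m : ℤ, φ m = m) :
    Continuous (pushFun n φ) := by
  refine Continuous.if_le ((continuous_pt 1).comp (by fun_prop)) continuous_id continuous_const
    (by fun_prop) fun Q hQ => ?_
  have h0 : tent Q.1.1 = 0 := by rw [← Q.2.2.2, ← hQ, abs_zero]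
  obtain ⟨m, hm⟩ := tent_eq_zero_iff.1 h0
  rw [hm, hφ, ← hm]
  exact pt_one_of_nonneg hQ.le

lemma mem_Icc_of_fixed {φ : ℝ ≃o ℝ} (hφ : ∀ m : ℤ, φ m = m) (Q : necklace n) :
    0 ≤ φ Q.1.1 ∧ φ Q.1.1 ≤ n := by
  have h0 : φ 0 = 0 := by simpa using hφ 0
  have hn : φ n = n := by simpa using hφ n
  exact ⟨h0 ▸ φ.monotone Q.2.1, hn ▸ φ.monotone Q.2.2.1⟩

lemma pushFun_symm_apply {φ : ℝ ≃o ℝ} (hφ : ∀ m : ℤ, φ m = m) (Q : necklace n) :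
    pushFun n φ.symm (pushFun n φ Q) = Q := by
  unfold pushFun
  by_cases h : 0 ≤ Q.1.2
  · obtain ⟨h0, h1⟩ := mem_Icc_of_fixed hφ Q
    have h2 : 0 ≤ (pt n 1 (φ Q.1.1)).1.2 := by
      rw [pt_val 1 h0 h1]
      simpa using tent_nonneg _
    rw [if_pos h, if_pos h2, pt_fst 1 h0 h1, φ.symm_apply_apply, pt_one_of_nonneg h]
  · rw [if_neg h, if_neg h]

/-- The homeomorphism of the necklace that moves the points of the upper side by `φ`. -/
noncomputable def push (n : ℕ) (φ : ℝ ≃o ℝ) (hφ : ∀ m : ℤ, φ m = m) :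
    necklace n ≃ₜ necklace n where
  toFun := pushFun n φ
  invFun := pushFun n φ.symm
  left_inv := pushFun_symm_apply hφ
  right_inv Q := pushFun_symm_apply (φ := φ.symm)
    (fun m => by rw [OrderIso.symm_apply_eq, hφ]) Q
  continuous_toFun := continuous_pushFun φ.continuous hφ
  continuous_invFun := continuous_pushFun φ.symm.continuous
    fun m => by rw [OrderIso.symm_apply_eq, hφ]

lemma abs_le_half_of_fixed {φ : ℝ ≃o ℝ} (h1 : φ (1 / 2) = 1 / 2) (h2 : φ (-(1 / 2)) = -(1 / 2))
    {y : ℝ} (hy : |y| ≤ 1 / 2) : |φ y| ≤ 1 / 2 := by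
  rw [abs_le] at hy ⊢
  constructor
  · rw [← h2]
    exact φ.monotone hy.1
  · rw [← h1]
    exact φ.monotone hy.2

lemma abs_snd_le (Q : necklace n) : |Q.1.2| ≤ 1 / 2 := Q.2.2.2.trans_le (tent_le_half _)

lemma abs_mem (hn : 0 < n) {y : ℝ} (hy : |y| ≤ 1 / 2) : (|y|, y) ∈ necklace n := by
  have hn' : (1 : ℝ) ≤ n := mod_cast hn
  refine ⟨abs_nonneg _, ?_, (tent_eq_self (abs_nonneg _) hy).symm⟩
  simp only
  linarith

lemma eq_abs_of_le {Q : necklace n} (hQ : Q.1.1 ≤ 1 / 2) : Q.1.1 = |Q.1.2| := by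
  rw [Q.2.2.2, tent_eq_self Q.2.1 hQ]

open Classical in
/-- The map of the necklace that moves the points near the left end vertically by `φ`. -/
noncomputable def bendFun (n : ℕ) (φ : ℝ → ℝ) (Q : necklace n) : necklace n :=
  if Q.1.1 ≤ 1 / 2 then
    -- Over `[0, 1/2]` the necklace is the curve `x = |y|`, so `y` is a coordinate in which the left
    -- end is an interior point. The default `Q` is never reached when `n > 0` and `φ` is an order
    -- isomorphism fixing `±1/2`.
    if h : (|φ Q.1.2|, φ Q.1.2) ∈ necklace n then ⟨_, h⟩ else Q
  else Q

lemma bendFun_of_le (hn : 0 < n) {φ : ℝ ≃o ℝ} (h1 : φ (1 / 2) = 1 / 2)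
    (h2 : φ (-(1 / 2)) = -(1 / 2)) {Q : necklace n} (hQ : Q.1.1 ≤ 1 / 2) :
    (bendFun n φ Q).1 = (|φ Q.1.2|, φ Q.1.2) := by
  unfold bendFun
  rw [if_pos hQ, dif_pos (abs_mem hn (abs_le_half_of_fixed h1 h2 (abs_snd_le Q)))]

lemma bendFun_of_gt {φ : ℝ → ℝ} {Q : necklace n} (hQ : 1 / 2 < Q.1.1) : bendFun n φ Q = Q :=
  if_neg hQ.not_ge

lemma continuous_bendFun (hn : 0 < n) {φ : ℝ ≃o ℝ} (h1 : φ (1 / 2) = 1 / 2)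
    (h2 : φ (-(1 / 2)) = -(1 / 2)) : Continuous (bendFun n φ) := by
  rw [continuous_induced_rng]
  have h3 : Continuous φ := φ.continuous
  have : (Subtype.val ∘ bendFun n φ) =
      fun Q : necklace n => if Q.1.1 ≤ 1 / 2 then (|φ Q.1.2|, φ Q.1.2) else Q.1 := by
    ext1 Q
    rw [Function.comp_apply]
    split_ifs with h
    · exact bendFun_of_le hn h1 h2 h
    · rw [bendFun_of_gt (not_le.1 h)]
  rw [this]
  refine Continuous.if_le (by fun_prop) continuous_subtype_val (by fun_prop) continuous_const
    fun Q hQ => ?_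
  have h4 := eq_abs_of_le hQ.le
  have h5 : φ Q.1.2 = Q.1.2 := by
    rcases abs_choice Q.1.2 with h | h
    · rw [← h, ← h4, hQ, h1]
    · rw [← neg_neg Q.1.2, ← h, ← h4, hQ, h2]
  rw [h5, ← h4]

lemma bendFun_symm_apply (hn : 0 < n) {φ : ℝ ≃o ℝ} (h1 : φ (1 / 2) = 1 / 2)
    (h2 : φ (-(1 / 2)) = -(1 / 2)) (Q : necklace n) : bendFun n φ.symm (bendFun n φ Q) = Q := by
  rcases le_or_gt Q.1.1 (1 / 2) with h | h
  · have h3 := bendFun_of_le hn h1 h2 h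
    have h4 : (bendFun n φ Q).1.1 ≤ 1 / 2 := by
      rw [h3]
      exact abs_le_half_of_fixed h1 h2 (abs_snd_le Q)
    refine Subtype.ext ?_
    rw [bendFun_of_le hn (by rw [OrderIso.symm_apply_eq, h1]) (by rw [OrderIso.symm_apply_eq, h2])
      h4, h3, φ.symm_apply_apply, ← eq_abs_of_le h]
  · rw [bendFun_of_gt h, bendFun_of_gt h]

/-- The homeomorphism of the necklace that moves the points near the left end vertically by `φ`. -/
noncomputable def bend (hn : 0 < n) (φ : ℝ ≃o ℝ) (h1 : φ (1 / 2) = 1 / 2)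
    (h2 : φ (-(1 / 2)) = -(1 / 2)) : necklace n ≃ₜ necklace n where
  toFun := bendFun n φ
  invFun := bendFun n φ.symm
  left_inv := bendFun_symm_apply hn h1 h2
  right_inv Q := bendFun_symm_apply (φ := φ.symm) hn (by rw [OrderIso.symm_apply_eq, h1])
    (by rw [OrderIso.symm_apply_eq, h2]) Q
  continuous_toFun := continuous_bendFun hn h1 h2
  continuous_invFun := continuous_bendFun hn (by rw [OrderIso.symm_apply_eq, h1])
    (by rw [OrderIso.symm_apply_eq, h2])

/-- The group of homeomorphisms of the necklace that preserve the strata of the rescaled depth. -/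
def strataGroup (n e : ℕ) : Subgroup (necklace n ≃ₜ necklace n) where
  carrier := {h | ∀ Q, stratum (rescale e (depth (h Q))) = stratum (rescale e (depth Q))}
  one_mem' _ := rfl
  mul_mem' {g h} hg hh Q := (hg (h Q)).trans (hh Q)
  inv_mem' {h} hh Q := by
    have h1 : h (h⁻¹ Q) = Q := h.apply_symm_apply Q
    have := hh (h⁻¹ Q)
    rw [h1] at this
    exact this.symm

/-- The two reflections preserve depth, hence lie in the group for every `e`, and together they
bring any point to the upper left side. -/
lemma exists_strataGroup_apply_eq_pt (e : ℕ) (Q : necklace n) :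
    ∃ g ∈ strataGroup n e, g Q = pt n 1 (depth Q) := by
  have hflip : ∀ Q : necklace n, ∃ g ∈ strataGroup n e, g Q = pt n 1 Q.1.1 := fun Q => by
    rcases le_total 0 Q.1.2 with h | h
    · exact ⟨1, one_mem _, (pt_one_of_nonneg h).symm⟩
    · refine ⟨flip n, fun Q => by rw [depth_flip], ?_⟩
      exact (pt_one_of_nonneg (Q := flip n Q) (neg_nonneg.2 h)).symm
  rcases min_choice Q.1.1 (n - Q.1.1) with h | h
  · rw [depth, h]
    exact hflip Q
  · rw [depth, h]
    obtain ⟨g, hg, hgQ⟩ := hflip (mirror n Q)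
    exact ⟨g * mirror n, mul_mem hg fun Q => by rw [depth_mirror], hgQ⟩

/-- Two points of positive depth on the upper left side in the same open stratum are related. -/
lemma exists_push_eq {e : ℕ} {s t : ℝ} {m : ℤ} (hs0 : 0 < s) (ht0 : 0 < t) (hs : s ≤ n / 2)
    (ht : t ≤ n / 2) (hsm : stratum (rescale e s) = 2 * m + 1)
    (htm : stratum (rescale e t) = 2 * m + 1) :
    ∃ g ∈ strataGroup n e, g (pt n 1 s) = pt n 1 t := by
  rw [stratum_eq_odd] at hsm htm
  -- An order isomorphism supported in an interval inside `O` fixes all integers and keeps the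
  -- stratum. The segment between `s` and `t` lies in `O`: a positive integer is its own rescaling,
  -- so it cannot lie in the open stratum. Openness then provides a slightly larger interval `(a,
  -- b)`.
  let O : Set ℝ := {u | (m < rescale e (min u (n - u)) ∧ rescale e (min u (n - u)) < m + 1) ∧
    (0 < u ∧ u < n) ∧ tent u ≠ 0}
  have hO : IsOpen O := by
    have hc : Continuous fun u : ℝ => rescale e (min u (n - u)) :=
      (continuous_rescale e).comp (by fun_prop)
    exact ((isOpen_lt continuous_const hc).inter (isOpen_lt hc continuous_const)).inter
      (((isOpen_lt continuous_const continuous_id).inter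
        (isOpen_lt continuous_id continuous_const)).inter
          (isOpen_ne_fun continuous_tent continuous_const))
  have hsub : ∀ u, min s t ≤ u → u ≤ max s t → u ∈ O := fun u h1 h2 => by
    have hu0 : 0 < u := (lt_min hs0 ht0).trans_le h1
    have hu1 : u ≤ n / 2 := h2.trans (max_le hs ht)
    have hr1 : (m : ℝ) < rescale e u := by
      refine lt_of_lt_of_le ?_ (monotone_rescale e h1)
      rcases min_choice s t with h | h <;> rw [h]
      exacts [hsm.1, htm.1]
    have hr2 : rescale e u < m + 1 := by
      refine lt_of_le_of_lt (monotone_rescale e h2) ?_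
      rcases max_choice s t with h | h <;> rw [h]
      exacts [hsm.2, htm.2]
    have hmin : min u ((n : ℝ) - u) = u := min_eq_left (by linarith)
    refine ⟨by rw [hmin]; exact ⟨hr1, hr2⟩, ⟨hu0, by linarith⟩, fun h => ?_⟩
    obtain ⟨j, rfl⟩ := tent_eq_zero_iff.1 h
    have hj : (1 : ℝ) ≤ j := by exact_mod_cast (by exact_mod_cast hu0 : 0 < j)
    rw [rescale_of_ge e (by linarith)] at hr1 hr2
    have h3 : m < j := by exact_mod_cast hr1
    have h4 : j < m + 1 := by exact_mod_cast hr2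
    omega
  obtain ⟨a, ha, ha'⟩ := exists_Ioc_subset_of_mem_nhds
    (hO.mem_nhds (hsub _ le_rfl min_le_max)) (exists_lt _)
  obtain ⟨b, hb, hb'⟩ := exists_Ico_subset_of_mem_nhds
    (hO.mem_nhds (hsub _ min_le_max le_rfl)) (exists_gt _)
  have hab : Set.Ioo a b ⊆ O := fun u hu => by
    rcases le_total u (min s t) with h | h
    · exact ha' ⟨hu.1, h⟩
    rcases le_total u (max s t) with h' | h'
    · exact hsub u h h'
    · exact hb' ⟨h', hu.2⟩
  obtain ⟨φ, hφs, hφ⟩ := exists_orderIso_of_mem_Ioo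
    (show s ∈ Set.Ioo a b from
      ⟨ha.trans_le (min_le_left _ _), (le_max_left _ _).trans_lt hb⟩)
    (show t ∈ Set.Ioo a b from
      ⟨ha.trans_le (min_le_right _ _), (le_max_right _ _).trans_lt hb⟩)
  have hint : ∀ j : ℤ, φ j = j := fun j => hφ _ fun h => (hab h).2.2 (tent_intCast j)
  refine ⟨push n φ hint, fun Q => ?_, ?_⟩
  · change stratum (rescale e (depth (pushFun n φ Q))) = _
    unfold pushFun
    split_ifs with h
    · by_cases hQ : Q.1.1 ∈ Set.Ioo a b
      · obtain ⟨h1, h2⟩ := mem_Icc_of_fixed hint Q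
        have h3 := stratum_eq_odd.2 (hab hQ).1
        have h4 := stratum_eq_odd.2 (hab (OrderIso.mem_Ioo_of_fixed hφ hQ)).1
        rw [depth, pt_fst 1 h1 h2, h4, depth, h3]
      · rw [hφ _ hQ, pt_one_of_nonneg h]
    · rfl
  · change pushFun n φ _ = _
    have h0 : 0 ≤ (pt n 1 s).1.2 := by
      rw [pt_val 1 hs0.le (by linarith)]
      simpa using tent_nonneg _
    rw [pushFun, if_pos h0, pt_fst 1 hs0.le (by linarith), hφs]

/-- If the left end lies in an open stratum, it is related to a point of positive depth. -/
lemma exists_bend_eq (hn : 0 < n) {e : ℕ} {m : ℤ} (h0 : stratum (rescale e 0) = 2 * m + 1) :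
    ∃ g ∈ strataGroup n e, ∃ t : ℝ, 0 < t ∧ t ≤ n / 2 ∧ stratum (rescale e t) = 2 * m + 1 ∧
      g (pt n 1 0) = pt n 1 t := by
  have hn' : (1 : ℝ) ≤ n := mod_cast hn
  have hO : IsOpen {u : ℝ | m < rescale e u ∧ rescale e u < m + 1} :=
    (isOpen_lt continuous_const (continuous_rescale e)).inter
      (isOpen_lt (continuous_rescale e) continuous_const)
  obtain ⟨b₀, hb₀, hb₀'⟩ := exists_Ico_subset_of_mem_nhds
    (hO.mem_nhds (stratum_eq_odd.1 h0)) (exists_gt _)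
  -- With `b ≤ b₀` all depths in `[0, b)` stay in the stratum of 0; with `b ≤ 1 / 2` a map supported
  -- in `(-b, b)` fixes `±1/2`, as `bend` requires.
  obtain ⟨b, hb, hbb₀, hb2⟩ : ∃ b : ℝ, 0 < b ∧ b ≤ b₀ ∧ b ≤ 1 / 2 :=
    ⟨min b₀ (1 / 2), lt_min hb₀ (by norm_num), min_le_left _ _, min_le_right _ _⟩
  have hcell : ∀ u, 0 ≤ u → u < b → stratum (rescale e u) = 2 * m + 1 := fun u h1 h2 =>
    stratum_eq_odd.2 (hb₀' ⟨h1, h2.trans_le hbb₀⟩)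
  obtain ⟨φ, hφs, hφ⟩ := exists_orderIso_of_mem_Ioo
    (show (0 : ℝ) ∈ Set.Ioo (-b) b from ⟨by linarith, hb⟩)
    (show b / 2 ∈ Set.Ioo (-b) b from ⟨by linarith, by linarith⟩)
  have h1 : φ (1 / 2) = 1 / 2 := hφ _ fun h => by linarith [h.2]
  have h2 : φ (-(1 / 2)) = -(1 / 2) := hφ _ fun h => by linarith [h.1]
  have hdepth : ∀ Q : necklace n, Q.1.1 ≤ 1 / 2 → depth Q = Q.1.1 := fun Q hQ =>
    min_eq_left (by linarith)
  refine ⟨bend hn φ h1 h2, fun Q => ?_, b / 2, by linarith, by linarith,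
    hcell _ (by linarith) (by linarith), ?_⟩
  · change stratum (rescale e (depth (bendFun n φ Q))) = _
    rcases le_or_gt Q.1.1 (1 / 2) with h | h
    · have h3 := bendFun_of_le hn h1 h2 h
      have h4 : (bendFun n φ Q).1.1 = |φ Q.1.2| := by rw [h3]
      rw [hdepth Q h, hdepth _ (h4.trans_le (abs_le_half_of_fixed h1 h2 (abs_snd_le Q))), h4,
        eq_abs_of_le h]
      by_cases hQ : Q.1.2 ∈ Set.Ioo (-b) b
      · rw [hcell _ (abs_nonneg _) (abs_lt.2 hQ),
          hcell _ (abs_nonneg _) (abs_lt.2 (OrderIso.mem_Ioo_of_fixed hφ hQ))]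
      · rw [hφ _ hQ]
    · rw [bendFun_of_gt h]
  · have hz : (pt n 1 0).1 = (0, 0) := by
      rw [pt_val 1 le_rfl (Nat.cast_nonneg n)]
      simp
    refine Subtype.ext ?_
    change (bendFun n φ _).1 = _
    rw [bendFun_of_le hn h1 h2 (by rw [hz]; norm_num), hz, pt_val 1 (by linarith) (by linarith)]
    simp only [hφs, tent_eq_self (by linarith : 0 ≤ b / 2) (by linarith),
      abs_of_pos (by linarith : 0 < b / 2)]
    simp

/-- A point stratum contains a single depth. In an open stratum, `bend` first moves the left end off
depth 0 if necessary, since `push` fixes it; then `push` joins the two positive depths. -/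
lemma exists_strataGroup_pt_eq (hn : 0 < n) {e : ℕ} {s t : ℝ} (hs0 : 0 ≤ s) (ht0 : 0 ≤ t)
    (hs : s ≤ n / 2) (ht : t ≤ n / 2) (hst : stratum (rescale e s) = stratum (rescale e t)) :
    ∃ g ∈ strataGroup n e, g (pt n 1 s) = pt n 1 t := by
  obtain ⟨m, hm | hm⟩ := Int.even_or_odd' (stratum (rescale e t))
  · rw [hm] at hst
    rw [eq_of_rescale_eq_intCast (stratum_eq_even.1 hst) (stratum_eq_even.1 hm)]
    exact ⟨1, one_mem _, rfl⟩
  · rw [hm] at hst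
    have key : ∀ s : ℝ, 0 ≤ s → s ≤ n / 2 → stratum (rescale e s) = 2 * m + 1 →
        ∃ g ∈ strataGroup n e, ∃ u : ℝ, 0 < u ∧ u ≤ n / 2 ∧ stratum (rescale e u) = 2 * m + 1 ∧
          g (pt n 1 s) = pt n 1 u := fun s h0 h1 h2 => by
      rcases h0.eq_or_lt with rfl | h0
      · exact exists_bend_eq hn h2
      · exact ⟨1, one_mem _, s, h0, h1, h2, rfl⟩
    obtain ⟨g₁, hg₁, u, hu0, hu1, hu2, hgu⟩ := key s hs0 hs hst
    obtain ⟨g₂, hg₂, v, hv0, hv1, hv2, hgv⟩ := key t ht0 ht hm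
    obtain ⟨g, hg, huv⟩ := exists_push_eq hu0 hv0 hu1 hv1 hu2 hv2
    refine ⟨g₂⁻¹ * (g * g₁), mul_mem (inv_mem hg₂) (mul_mem hg hg₁), ?_⟩
    change g₂.symm (g (g₁ (pt n 1 s))) = _
    rw [hgu, huv, ← hgv, g₂.symm_apply_apply]

lemma strataGroup_transitive (hn : 0 < n) {e : ℕ} (P Q : necklace n)
    (h : stratum (rescale e (depth P)) = stratum (rescale e (depth Q))) :
    ∃ g : strataGroup n e, g • P = Q := by
  obtain ⟨g₁, hg₁, h₁⟩ := exists_strataGroup_apply_eq_pt e P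
  obtain ⟨g₂, hg₂, h₂⟩ := exists_strataGroup_apply_eq_pt e Q
  obtain ⟨g, hg, hgPQ⟩ := exists_strataGroup_pt_eq hn (depth_nonneg P) (depth_nonneg Q)
    (depth_le P) (depth_le Q) h
  refine ⟨⟨g₂⁻¹ * (g * g₁), mul_mem (inv_mem hg₂) (mul_mem hg hg₁)⟩, ?_⟩
  change g₂.symm (g (g₁ P)) = _
  rw [h₁, hgPQ, ← h₂, g₂.symm_apply_apply]

/-- The group is arbitrary so that the bound serves three cases: all groups with `e = 0`, the strata
group of a given `e`, and the trivial group with every `e`. -/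
lemma le_invariantHeight_of_strataGroup (p e : ℕ) {G : Type*} [Group G]
    [MulAction G (necklace (p + 1))]
    (hinv : ∀ (g : G) (Q : necklace (p + 1)),
      stratum (rescale e (depth (g • Q))) = stratum (rescale e (depth Q))) :
    ((p + e : ℕ) : ℕ∞) ≤ invariantHeight G (Set.univ : Set (necklace (p + 1))) :=
  le_invariantHeight_of_strata ((continuous_rescale e).comp continuous_depth)
    (by push_cast; ring) (range_stratum_depth (Nat.succ_pos p) e) hinv

lemma invariantHeight_strataGroup (p e : ℕ) :
    invariantHeight (strataGroup (p + 1) e) (Set.univ : Set (necklace (p + 1))) =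
      ((p + e : ℕ) : ℕ∞) :=
  le_antisymm
    (invariantHeight_le_of_strata (by push_cast; ring)
      (range_stratum_depth (Nat.succ_pos p) e) (strataGroup_transitive (Nat.succ_pos p)))
    (le_invariantHeight_of_strataGroup p e fun g Q => g.2 Q)

end necklace

/-! ### The set of possible heights -/

theorem mainTheorem1 (p : ℕ) :
    ∃ (X : Type) (_ : MetricSpace X), IsTopologicalGraph X ∧
      possibleHeights X = {h : ℕ∞ | ∃ k : ℕ, p ≤ k ∧ h = (k : ℕ∞)} ∪ {⊤} := by
  refine ⟨necklace (p + 1), inferInstance, necklace.isTopologicalGraph (Nat.succ_pos p), ?_⟩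
  apply Set.Subset.antisymm
  · rintro _ ⟨G, _, _, _, _, _, rfl⟩
    have hp : ((p + 0 : ℕ) : ℕ∞) ≤ invariantHeight G (Set.univ : Set (necklace (p + 1))) :=
      necklace.le_invariantHeight_of_strataGroup p 0 fun g Q =>
        necklace.stratum_depth_map (Homeomorph.smul g) Q
    induction h : invariantHeight G (Set.univ : Set (necklace (p + 1))) using ENat.recTopCoe with
    | top => exact Or.inr rfl
    | coe k =>
      rw [h] at hp
      exact Or.inl ⟨k, by exact_mod_cast hp, rfl⟩
  · rintro _ (⟨k, hk, rfl⟩ | rfl)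
    · obtain ⟨e, rfl⟩ := Nat.exists_eq_add_of_le hk
      rw [← necklace.invariantHeight_strataGroup]
      exact invariantHeight_mem_possibleHeights _
    · have htop : invariantHeight (⊥ : Subgroup (necklace (p + 1) ≃ₜ necklace (p + 1)))
          (Set.univ : Set (necklace (p + 1))) = ⊤ := by
        -- The trivial group leaves every stratum invariant, so its height is at least `p + e` for
        -- each `e`.
        refine ENat.eq_top_iff_forall_ge.2 fun e => ?_
        refine le_trans ?_ (necklace.le_invariantHeight_of_strataGroup p e fun g Q => ?_)
        · exact_mod_cast Nat.le_add_left e p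
        · have hg : g = 1 := Subsingleton.elim _ _
          rw [hg, one_smul]
      rw [← htop]
      exact invariantHeight_mem_possibleHeights _
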